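/- **Setting.** Let $X\subseteq\mathbb R^n$ be compact and convex, let $A^{(1)},\dots,A^{(m)}\in\mathbb R^{n\times d}$, and let $\mathbb P_\xi$ be a probability law on $\mathbb R^d$ with the following property. Let $C$ be either $\mathbb R^d$ or $\mathbb R^d_+$ (the nonnegative orthant). The law $\mathbb P_\xi$ has density $\exp(-Q(z))$ for $z\in C$ (and no mass outside $C$), where $Q$ is a real-valued measurable function that is multivariate regularly varying on $C$ with index $\alpha>0$: there are a slowly varying function $h:\mathbb R_+\to\mathbb R_+$ (that is, $h(tx)/h(t)\to1$ as $t\to\infty$, for every $x>0$) and a continuous function $\lambda:C\to\mathbb R_+$ with $\lambda(z)>0$ for $z\neq0$, such that $q(u):=h(u)u^\alpha$ is nondecreasing and continuous for all sufficiently large $u$, and $$\lim_{u\to\infty,\ z'\to z,\ z'\in C}\frac{Q(uz')}{q(u)}=\lambda(z)\qquad\text{for every } z\in C\setminus\{0\}.$$ For $x\in X$ let $V(x)=\mathbb P_\xi\big(\max_{i} x^\top A^{(i)}\xi>1\big)$. For $s\ge 1$ and $N\in\mathbb N$ let $\xi^{(N,1)},\dots,\xi^{(N,N)}$ be i.i.d.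 samples from $\mathbb P_\xi$; the joint law of the samples belonging to different $N$ is arbitrary (for example, they may be the first $N$ terms of a single i.i.d. sequence). A point $x$ is feasible for the scaled sampled problem $(\mathrm{SSP}_{N,s})$ if $x\in X$ and $\max_i x^\top A^{(i)}\xi^{(N,j)}\le 1/s$ for $j=1,\dots,N$. Put $\underline N(\varepsilon,\beta)=\big\lceil\frac2\varepsilon\big(\log\frac1\beta+n\big)\big\rceil$. **Theorem.** Fix $s\ge1$ and $\beta\in(0,1)$. 1. There is an event of probability at least $1-\beta$ on which the following holds. For all families $(N_\varepsilon)_{\varepsilon>0}$ of natural numbers and $(x_\varepsilon)_{\varepsilon>0}$ of points of $\mathbb R^n$ (both may depend on the samples) such that, for all sufficiently small $\varepsilon>0$, $N_\varepsilon\ge\underline N(\varepsilon^{s^{-\alpha}},\beta)$ and $x_\varepsilon$ is feasible for $(\mathrm{SSP}_{N_\varepsilon,s})$, one has $$\liminf_{\varepsilon\to0^+}\frac{\log V(x_\varepsilon)}{\log\varepsilon}\ge1$$ (with $\log 0=-\infty$, so that the ratio is $+\infty$ where $V(x_\varepsilon)=0$). Consequently, for every $\delta>0$, $V(x_\varepsilon)\le\varepsilon^{1-\delta}$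 for all sufficiently small $\varepsilon>0$, i.e. $V(x_\varepsilon)\le\varepsilon^{1-o(1)}$. 2. The reduction in sample size is exponential: $$\lim_{\varepsilon\to0^+}\frac{\log\underline N(\varepsilon^{s^{-\alpha}},\beta)}{\log\underline N(\varepsilon,\beta)}=\frac1{s^\alpha}.$$ -/

import Mathlib

open Filter Topology MeasureTheory ProbabilityTheory
open scoped Matrix ENNReal

namespace ScaledScenario

/-- The two admissible cones: all of `ℝ^d`, or the nonnegative orthant `ℝ^d_+`. -/
def IsSupportCone {d : ℕ} (C : Set (Fin d → ℝ)) : Prop :=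
  C = Set.univ ∨ C = {z | ∀ k, 0 ≤ z k}

/-- `h : ℝ_+ → ℝ_+` is slowly varying at infinity. -/
def SlowlyVarying (h : ℝ → ℝ) : Prop :=
  (∀ t, 0 ≤ t → 0 ≤ h t) ∧
    ∀ x, 0 < x → Tendsto (fun t : ℝ => h (t * x) / h t) atTop (𝓝 1)

/-- The law `P` has density `exp (-Q)` on the cone `C` (and no mass outside `C`), and `Q` is
multivariate regularly varying on `C` with index `α`: with `q u = h u * u ^ α`, one has
`Q (u z') / q u → lam z` as `u → ∞` and `z' → z` in `C`, for every nonzero `z` in `C`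
(locally uniform convergence away from the origin), where the continuous limit function `lam`
is positive away from the origin. -/
structure HasMRVDensity {d : ℕ} (P : Measure (Fin d → ℝ)) (C : Set (Fin d → ℝ)) (α : ℝ)
    (Q : (Fin d → ℝ) → ℝ) (h : ℝ → ℝ) (lam : (Fin d → ℝ) → ℝ) : Prop where
  measurable_Q : Measurable Q
  density : P = volume.withDensity (C.indicator fun z => ENNReal.ofReal (Real.exp (-Q z)))
  index_pos : 0 < α
  slowly_varying : SlowlyVarying h
  eventually_increasing_continuous : ∃ u₀ : ℝ, 0 < u₀ ∧
    MonotoneOn (fun u : ℝ => h u * u ^ α) (Set.Ici u₀) ∧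
    ContinuousOn (fun u : ℝ => h u * u ^ α) (Set.Ici u₀)
  continuous_lam : ContinuousOn lam C
  lam_nonneg : ∀ z ∈ C, 0 ≤ lam z
  lam_pos : ∀ z ∈ C, z ≠ 0 → 0 < lam z
  limit : ∀ z ∈ C, z ≠ 0 →
    Tendsto (fun p : ℝ × (Fin d → ℝ) => Q (p.1 • p.2) / (h p.1 * p.1 ^ α))
      (atTop ×ˢ 𝓝[C] z) (𝓝 (lam z))

/-- The violation probability `V x = P (max_i xᵀ A⁽ⁱ⁾ ξ > 1)`, where `ξ` has law `P`. -/
noncomputable def violation {n d m : ℕ} (A : Fin m → Matrix (Fin n) (Fin d) ℝ)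
    (P : Measure (Fin d → ℝ)) (x : Fin n → ℝ) : ℝ≥0∞ :=
  P {z | ∃ i, 1 < x ⬝ᵥ (A i *ᵥ z)}

/-- `x` is feasible for the scaled sampled problem with scaling factor `s` and samples
`ξ 0, …, ξ (N - 1)`: `x ∈ X` and `max_i xᵀ A⁽ⁱ⁾ ξ j ≤ 1 / s` for every `j`. -/
def Feasible {n d m N : ℕ} (X : Set (Fin n → ℝ)) (A : Fin m → Matrix (Fin n) (Fin d) ℝ)
    (s : ℝ) (ξ : Fin N → Fin d → ℝ) (x : Fin n → ℝ) : Prop :=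
  x ∈ X ∧ ∀ j i, x ⬝ᵥ (A i *ᵥ ξ j) ≤ 1 / s

/-- The scenario sample size `⌈(2 / ε) (log (1 / β) + n)⌉`. -/
noncomputable def sampleSize (n : ℕ) (ε β : ℝ) : ℕ :=
  ⌈2 / ε * (Real.log (1 / β) + n)⌉₊

end ScaledScenario

/-! Write q(u) = h(u)u^α and pick u with q(u) = log N. The limit function is homogeneous of degree
α, so its level set {lam = 1 - τ} is compact. By uniform regular variation, every grid cell of fixed
side η near u times that level set has mass at least N^(η-1), because Q there is at most (1 - τ/2)
log N. Only polynomially many cells matter and each is missed with probability at most exp(-N^η), so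
Borel–Cantelli shows that almost surely, for all large N, every such cell contains a sample
(`ae_eventually_gridCell_hit`).

Hence a feasible x satisfies xᵀA⁽ⁱ⁾(uw) ≤ 1/s + τ on the whole level set. Constraints are linear
along rays, so any violating z has lam z ≥ M u^α with M = (1-τ)/(1/s+τ)^α
(`violation_le_superlevel`). This superlevel set has mass at most K exp(-(M-2τ)q(u)) = K N^(-(M-2τ))
(`exists_superlevel_le`). As τ → 0 the exponent M - 2τ tends to s^α, so V(x) ≤ N^(-ρ) for each ρ <
s^α, uniformly over feasible x. Inserting N ≥ const · ε^(-s^(-α)) gives ε^(1-δ). The event found has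
probability one; β enters only through the sample size. -/

namespace ScaledScenario

/-! ### Growth of the normalizing function -/

section Growth

variable {q : ℝ → ℝ} {α : ℝ}

/-- Potter-type bound: far out, each doubling of u multiplies q by more than 2^(α/2). Induction over
dyadic blocks carries this to all large u, and monotonicity covers the first block. It makes q
dominate logarithms. -/
theorem exists_rpow_le_of_tendsto_doubling (hα : 0 < α) {u₀ : ℝ} (hmono : MonotoneOn q (Set.Ici u₀))
    (hpos : ∀ᶠ u in atTop, 0 < q u)
    (hlim : Tendsto (fun u => q (u * 2) / q u) atTop (𝓝 (2 ^ α))) :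
    ∃ c > 0, ∀ᶠ u in atTop, c * u ^ (α / 2) ≤ q u := by
  have hlt : (2 : ℝ) ^ (α / 2) < 2 ^ α := Real.rpow_lt_rpow_of_exponent_lt (by norm_num) (by linarith)
  obtain ⟨T, hT⟩ := eventually_atTop.1 (((hlim.eventually (lt_mem_nhds hlt)).and hpos).and
    (eventually_ge_atTop (max u₀ 1)))
  have hTT : max u₀ 1 ≤ T := (hT T le_rfl).2
  have hT1 : 1 ≤ T := (le_max_right _ _).trans hTT
  have hT0 : u₀ ≤ T := (le_max_left _ _).trans hTT
  have hqT : 0 < q T := (hT T le_rfl).1.2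
  refine ⟨q T / (2 * T) ^ (α / 2), by positivity, ?_⟩
  have key : ∀ k : ℕ, ∀ u, T ≤ u → u ≤ 2 ^ (k + 1) * T →
      q T / (2 * T) ^ (α / 2) * u ^ (α / 2) ≤ q u := by
    have base : ∀ u, T ≤ u → u ≤ 2 * T → q T / (2 * T) ^ (α / 2) * u ^ (α / 2) ≤ q u := by
      intro u hu hu2
      have h1 : q T ≤ q u := hmono hT0 (hT0.trans hu) hu
      have h2 : u ^ (α / 2) ≤ (2 * T) ^ (α / 2) :=
        Real.rpow_le_rpow (by linarith) hu2 (by linarith)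
      refine le_trans ?_ h1
      rw [div_mul_eq_mul_div, div_le_iff₀ (by positivity)]
      gcongr
    intro k
    induction k with
    | zero => intro u hu hu2; exact base u hu (by simpa using hu2)
    | succ k ih =>
      intro u hu hu2
      by_cases h2 : u ≤ 2 * T
      · exact base u hu h2
      push Not at h2
      have h3 := ih (u / 2) (by linarith) (by rw [pow_succ] at hu2; linarith)
      have h4 := (hT (u / 2) (by linarith)).1
      have h5 := h4.1
      rw [lt_div_iff₀ h4.2, div_mul_cancel₀ u (by norm_num : (2 : ℝ) ≠ 0)] at h5
      have h6 : u ^ (α / 2) = 2 ^ (α / 2) * (u / 2) ^ (α / 2) := by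
        rw [← Real.mul_rpow (by norm_num) (by linarith)]; congr 1; ring
      rw [h6]
      calc _ = 2 ^ (α / 2) * (q T / (2 * T) ^ (α / 2) * (u / 2) ^ (α / 2)) := by ring
        _ ≤ 2 ^ (α / 2) * q (u / 2) := by gcongr
        _ ≤ q u := h5.le
  filter_upwards [eventually_ge_atTop T] with u hu
  obtain ⟨k, hk⟩ := pow_unbounded_of_one_lt (u / T) (by norm_num : (1 : ℝ) < 2)
  refine key k u hu ?_
  rw [div_lt_iff₀ (by linarith)] at hk
  rw [pow_succ]
  nlinarith

theorem tendsto_atTop_of_rpow_le (hα : 0 < α) {c : ℝ} (hc : 0 < c)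
    (hq : ∀ᶠ u in atTop, c * u ^ (α / 2) ≤ q u) : Tendsto q atTop atTop :=
  tendsto_atTop_mono' _ hq
    ((tendsto_rpow_atTop (by linarith : 0 < α / 2)).const_mul_atTop hc)

theorem eventually_log_le_of_rpow_le (hα : 0 < α) {c : ℝ} (hc : 0 < c)
    (hq : ∀ᶠ u in atTop, c * u ^ (α / 2) ≤ q u) {B κ : ℝ} (hB : 0 ≤ B) (hκ : 0 < κ) :
    ∀ᶠ u in atTop, Real.log (1 + B * u) ≤ κ * q u := by
  have h1 := (isLittleO_log_rpow_atTop (by linarith : 0 < α / 2)).def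
    (by positivity : 0 < κ * c / 2)
  have h2 : ∀ᶠ u : ℝ in atTop, Real.log (1 + B) ≤ κ * c / 2 * u ^ (α / 2) :=
    ((tendsto_rpow_atTop (by linarith : 0 < α / 2)).const_mul_atTop
      (by positivity : 0 < κ * c / 2)).eventually_ge_atTop _
  filter_upwards [h1, h2, hq, eventually_ge_atTop 1] with u h1 h2 h3 hu
  have hlog : Real.log (1 + B * u) ≤ Real.log (1 + B) + Real.log u := by
    rw [← Real.log_mul (by positivity) (by positivity)]
    exact Real.log_le_log (by positivity) (by nlinarith)
  rw [Real.norm_of_nonneg (Real.log_nonneg hu), Real.norm_of_nonneg (by positivity)] at h1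
  nlinarith [mul_le_mul_of_nonneg_left h3 hκ.le]

end Growth

/-! ### The cone and the limit function: homogeneity, compact level sets, uniformity -/

theorem IsSupportCone.isClosed {d : ℕ} {C : Set (Fin d → ℝ)} (hC : IsSupportCone C) :
    IsClosed C := by
  rcases hC with rfl | rfl
  · exact isClosed_univ
  · simp only [Set.ofPred_forall]
    exact isClosed_iInter fun k => isClosed_le continuous_const (continuous_apply k)

theorem IsSupportCone.smul_mem {d : ℕ} {C : Set (Fin d → ℝ)} (hC : IsSupportCone C) {t : ℝ}
    (ht : 0 ≤ t) {z : Fin d → ℝ} (hz : z ∈ C) : t • z ∈ C := by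
  rcases hC with rfl | rfl
  · trivial
  · exact fun k => mul_nonneg ht (hz k)

namespace HasMRVDensity

variable {d : ℕ} {P : Measure (Fin d → ℝ)} {C : Set (Fin d → ℝ)} {α : ℝ}
    {Q : (Fin d → ℝ) → ℝ} {h : ℝ → ℝ} {lam : (Fin d → ℝ) → ℝ}

theorem eventually_pos (hP : HasMRVDensity P C α Q h lam) :
    ∀ᶠ u in atTop, 0 < h u * u ^ α := by
  have h1 := (hP.slowly_varying.2 1 one_pos).eventually (lt_mem_nhds one_half_lt_one)
  filter_upwards [h1, eventually_gt_atTop 0] with u hu hu0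
  -- If h u = 0, the convention x / 0 = 0 makes the ratio 0, not above 1/2.
  have h2 : h u ≠ 0 := by
    intro h0
    rw [h0, div_zero] at hu
    norm_num at hu
  have := hP.slowly_varying.1 u hu0.le
  positivity

theorem tendsto_scale_ratio (hP : HasMRVDensity P C α Q h lam) {x : ℝ} (hx : 0 < x) :
    Tendsto (fun u => (h (u * x) * (u * x) ^ α) / (h u * u ^ α)) atTop (𝓝 (x ^ α)) := by
  have h1 := (hP.slowly_varying.2 x hx).mul_const (x ^ α)
  rw [one_mul] at h1
  refine h1.congr' ?_
  filter_upwards [eventually_gt_atTop 0] with u hu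
  rw [Real.mul_rpow hu.le hx.le]
  have : u ^ α ≠ 0 := by positivity
  rw [div_mul_eq_mul_div, ← mul_div_mul_right _ _ this]
  congr 1
  ring

theorem exists_rpow_le (hP : HasMRVDensity P C α Q h lam) :
    ∃ c > 0, ∀ᶠ u in atTop, c * u ^ (α / 2) ≤ h u * u ^ α := by
  obtain ⟨u₀, -, hm, -⟩ := hP.eventually_increasing_continuous
  exact exists_rpow_le_of_tendsto_doubling hP.index_pos hm hP.eventually_pos
    (hP.tendsto_scale_ratio two_pos)

theorem tendsto_atTop (hP : HasMRVDensity P C α Q h lam) :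
    Tendsto (fun u => h u * u ^ α) atTop atTop := by
  obtain ⟨c, hc, hq⟩ := hP.exists_rpow_le
  exact tendsto_atTop_of_rpow_le hP.index_pos hc hq

theorem eventually_log_le (hP : HasMRVDensity P C α Q h lam) {B κ : ℝ} (hB : 0 ≤ B)
    (hκ : 0 < κ) : ∀ᶠ u in atTop, Real.log (1 + B * u) ≤ κ * (h u * u ^ α) := by
  obtain ⟨c, hc, hq⟩ := hP.exists_rpow_le
  exact eventually_log_le_of_rpow_le hP.index_pos hc hq hB hκ

/-- Evaluate the limit of Q(u t z)/q(u) twice: directly at t z, and at z with scale u t, where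
q(ut)/q(u) → t^α. -/
theorem lam_smul (hP : HasMRVDensity P C α Q h lam) (hC : IsSupportCone C) {z : Fin d → ℝ}
    (hz : z ∈ C) (hz0 : z ≠ 0) {t : ℝ} (ht : 0 < t) : lam (t • z) = t ^ α * lam z := by
  have hlim : ∀ w ∈ C, w ≠ 0 →
      Tendsto (fun u : ℝ => Q (u • w) / (h u * u ^ α)) atTop (𝓝 (lam w)) := by
    intro w hw hw0
    exact (hP.limit w hw hw0).comp (tendsto_id.prodMk
      (tendsto_nhdsWithin_of_tendsto_nhds_of_eventually_within _ tendsto_const_nhds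
        (Eventually.of_forall fun _ => hw)))
  have h1 := hlim (t • z) (hC.smul_mem ht.le hz) (smul_ne_zero ht.ne' hz0)
  have hu : Tendsto (fun u : ℝ => u * t) atTop atTop := tendsto_id.atTop_mul_const ht
  have h2 := (hlim z hz hz0).comp hu
  have h3 := (hP.tendsto_scale_ratio ht).mul h2
  refine tendsto_nhds_unique h1 (h3.congr' ?_)
  filter_upwards [hu.eventually hP.eventually_pos] with u hu
  simp only [Function.comp, smul_smul]
  rw [div_mul_div_comm, mul_comm (h u * u ^ α), mul_div_mul_left _ _ hu.ne']

/-- The level set of the limit function away from the origin. -/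
def levelSet (C : Set (Fin d → ℝ)) (lam : (Fin d → ℝ) → ℝ) (M : ℝ) : Set (Fin d → ℝ) :=
  {z | z ∈ C ∧ z ≠ 0 ∧ lam z = M}

/-- By homogeneity it suffices to bound the limit function on the compact set of unit vectors of C.
-/
theorem exists_norm_rpow_le (hP : HasMRVDensity P C α Q h lam) (hC : IsSupportCone C) :
    ∃ c > 0, ∃ K, ∀ z ∈ C, z ≠ 0 → c * ‖z‖ ^ α ≤ lam z ∧ lam z ≤ K * ‖z‖ ^ α := by
  have hcomp : IsCompact (C ∩ Metric.sphere 0 1) := (isCompact_sphere 0 1).inter_left hC.isClosed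
  have hcont : ContinuousOn lam (C ∩ Metric.sphere 0 1) := hP.continuous_lam.mono Set.inter_subset_left
  have hne : ∀ w ∈ C ∩ Metric.sphere (0 : Fin d → ℝ) 1, w ≠ 0 := by
    rintro w ⟨-, hw⟩ rfl
    simp at hw
  obtain ⟨c, hc, hcb⟩ : ∃ c > 0, ∀ w ∈ C ∩ Metric.sphere 0 1, c ≤ lam w := by
    rcases (C ∩ Metric.sphere 0 1).eq_empty_or_nonempty with he | he
    · exact ⟨1, one_pos, by simp [he]⟩
    · obtain ⟨w, hw, hmin⟩ := hcomp.exists_isMinOn he hcont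
      exact ⟨lam w, hP.lam_pos w hw.1 (hne w hw), fun v hv => hmin hv⟩
  obtain ⟨K, hK⟩ := (hcomp.image_of_continuousOn hcont).bddAbove
  refine ⟨c, hc, K, fun z hz hz0 => ?_⟩
  have hn : 0 < ‖z‖ := norm_pos_iff.2 hz0
  have hw : ‖z‖⁻¹ • z ∈ C ∩ Metric.sphere 0 1 := by
    refine ⟨hC.smul_mem (by positivity) hz, ?_⟩
    simp [norm_smul, hn.ne']
  have hzw : lam z = ‖z‖ ^ α * lam (‖z‖⁻¹ • z) := by
    rw [← hP.lam_smul hC hw.1 (hne _ hw) hn, smul_smul, mul_inv_cancel₀ hn.ne', one_smul]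
  rw [hzw, mul_comm c, mul_comm K]
  exact ⟨by gcongr; exact hcb _ hw, by gcongr; exact hK ⟨_, hw, rfl⟩⟩

theorem isCompact_levelSet (hP : HasMRVDensity P C α Q h lam) (hC : IsSupportCone C) {M : ℝ}
    (hM : 0 < M) : IsCompact (levelSet C lam M) := by
  obtain ⟨c, hc, K, hcK⟩ := hP.exists_norm_rpow_le hC
  have hα := hP.index_pos
  -- The upper bound on `lam` keeps the level set at distance r from 0, so the open condition z ≠ 0
  -- becomes a closed one; |K| + 1 guarantees a positive denominator.
  set r : ℝ := (M / (|K| + 1)) ^ α⁻¹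
  set R : ℝ := (M / c) ^ α⁻¹
  have hr : 0 < r := by positivity
  have heq : levelSet C lam M =
      (C ∩ {z | r ≤ ‖z‖}) ∩ lam ⁻¹' {M} := by
    ext z
    constructor
    · rintro ⟨hz, hz0, rfl⟩
      refine ⟨⟨hz, ?_⟩, rfl⟩
      have h2 := (hcK z hz hz0).2
      rw [Set.mem_ofPred_eq, Real.rpow_inv_le_iff_of_pos (by positivity) (by positivity) hα,
        div_le_iff₀ (by positivity), mul_comm]
      refine h2.trans ?_
      gcongr
      exact (le_abs_self K).trans (by linarith)
    · rintro ⟨⟨hz, hzr⟩, hM'⟩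
      exact ⟨hz, norm_pos_iff.1 (hr.trans_le hzr), hM'⟩
  refine Metric.isCompact_of_isClosed_isBounded ?_ ?_
  · rw [heq]
    refine ContinuousOn.preimage_isClosed_of_isClosed
      (hP.continuous_lam.mono Set.inter_subset_left) ?_ isClosed_singleton
    exact hC.isClosed.inter (isClosed_le continuous_const continuous_norm)
  · refine (Metric.isBounded_closedBall (x := (0 : Fin d → ℝ)) (r := R)).subset ?_
    rintro z ⟨hz, hz0, rfl⟩
    have h1 := (hcK z hz hz0).1
    rw [mem_closedBall_zero_iff, Real.le_rpow_inv_iff_of_pos (by positivity) (by positivity) hα,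
      le_div_iff₀ hc, mul_comm]
    exact h1

/-- Regular variation is locally uniform at each point; compactness of the level set makes both the
radius and the threshold in u uniform. -/
theorem exists_uniform_ratio (hP : HasMRVDensity P C α Q h lam) (hC : IsSupportCone C) {M δ : ℝ}
    (hM : 0 < M) (hδ : 0 < δ) :
    ∃ r > 0, ∀ᶠ u in atTop, ∀ w ∈ levelSet C lam M, ∀ z ∈ C, dist z w < r →
      |Q (u • z) / (h u * u ^ α) - M| < δ := by
  have hcomp := hP.isCompact_levelSet hC hM
  -- The estimate holds on balls of radius 2r while balls of radius r form the cover, which leaves a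
  -- uniform neighbourhood of every point of the level set.
  have hloc : ∀ w ∈ levelSet C lam M, ∃ r > 0, ∀ᶠ u in atTop, ∀ z ∈ C, dist z w < 2 * r →
      |Q (u • z) / (h u * u ^ α) - M| < δ := by
    rintro w ⟨hw, hw0, rfl⟩
    have h1 := (hP.limit w hw hw0).eventually (Metric.ball_mem_nhds _ hδ)
    obtain ⟨pa, hpa, pb, hpb, hab⟩ := eventually_prod_iff.1 h1
    rw [eventually_nhdsWithin_iff, Metric.eventually_nhds_iff] at hpb
    obtain ⟨r, hr, hr'⟩ := hpb
    refine ⟨r / 2, by positivity, hpa.mono fun u hu z hz hzw => ?_⟩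
    have := hab hu (hr' (by linarith) hz)
    rwa [Real.dist_eq] at this
  choose! r hr hloc using hloc
  obtain ⟨t, ht, hcov⟩ := hcomp.elim_nhds_subcover (fun w => Metric.ball w (r w))
    fun w hw => Metric.ball_mem_nhds _ (hr w hw)
  obtain ⟨r₀, hr₀, hrt⟩ : ∃ r₀ > 0, ∀ w ∈ t, r₀ ≤ r w := by
    rcases t.eq_empty_or_nonempty with rfl | hne
    · exact ⟨1, one_pos, by simp⟩
    · obtain ⟨w, hw, hmin⟩ := t.exists_min_image r hne
      exact ⟨r w, hr w (ht w hw), hmin⟩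
  refine ⟨r₀, hr₀, ?_⟩
  have hall : ∀ᶠ u in atTop, ∀ w ∈ t, ∀ z ∈ C, dist z w < 2 * r w →
      |Q (u • z) / (h u * u ^ α) - M| < δ :=
    (Finset.eventually_all t).2 fun w hw => hloc w (ht w hw)
  filter_upwards [hall] with u hu w hw z hz hzw
  obtain ⟨v, hv, hwv⟩ := Set.mem_iUnion₂.1 (hcov hw)
  refine hu v hv z hz ?_
  have := dist_triangle z w v
  have := hrt v hv
  rw [Metric.mem_ball] at hwv
  linarith

end HasMRVDensity

/-! ### Grid cells -/

/-- The half-open cube of side `η` of the grid `η ℤ^d` with lower corner `η k`. -/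
def gridCell {d : ℕ} (η : ℝ) (k : Fin d → ℤ) : Set (Fin d → ℝ) :=
  Set.univ.pi fun i => Set.Ico (η * k i) (η * (k i + 1))

theorem measurableSet_gridCell {d : ℕ} (η : ℝ) (k : Fin d → ℤ) :
    MeasurableSet (gridCell η k) :=
  MeasurableSet.univ_pi fun _ => measurableSet_Ico

theorem volume_gridCell {d : ℕ} {η : ℝ} (k : Fin d → ℤ) :
    volume (gridCell η k) = ENNReal.ofReal η ^ d := by
  rw [gridCell, Real.volume_pi_Ico]
  simp [mul_add]

theorem mem_gridCell_floor {d : ℕ} {η : ℝ} (hη : 0 < η) (z : Fin d → ℝ) :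
    z ∈ gridCell η (fun i => ⌊z i / η⌋) := by
  intro i _
  have h1 := Int.floor_le (z i / η)
  have h2 := Int.lt_floor_add_one (z i / η)
  rw [le_div_iff₀ hη] at h1
  rw [div_lt_iff₀ hη] at h2
  exact ⟨by linarith, by linarith⟩

theorem dist_le_of_mem_gridCell {d : ℕ} {η : ℝ} (hη : 0 < η) {k : Fin d → ℤ}
    {y z : Fin d → ℝ} (hy : y ∈ gridCell η k) (hz : z ∈ gridCell η k) : dist y z ≤ η := by
  rw [dist_pi_le_iff hη.le]
  intro i
  have h1 := hy i trivial
  have h2 := hz i trivial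
  rw [Real.dist_eq, abs_le]
  constructor <;> linarith [h1.1, h1.2, h2.1, h2.2]

/-- The faces of the orthant are grid hyperplanes, so no cell straddles the boundary. -/
theorem IsSupportCone.gridCell_floor_subset {d : ℕ} {C : Set (Fin d → ℝ)} (hC : IsSupportCone C)
    {η : ℝ} (hη : 0 < η) {z : Fin d → ℝ} (hz : z ∈ C) :
    gridCell η (fun i => ⌊z i / η⌋) ⊆ C := by
  rcases hC with rfl | rfl
  · exact Set.subset_univ _
  · intro y hy i
    have h1 : (0 : ℝ) ≤ ⌊z i / η⌋ := by
      exact_mod_cast Int.floor_nonneg.2 (div_nonneg (hz i) hη.le)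
    exact (mul_nonneg hη.le h1).trans (hy i trivial).1

/-! ### Upper tail bound and lower cell bound for the law -/

namespace HasMRVDensity

variable {d : ℕ} {P : Measure (Fin d → ℝ)} {C : Set (Fin d → ℝ)} {α : ℝ}
    {Q : (Fin d → ℝ) → ℝ} {h : ℝ → ℝ} {lam : (Fin d → ℝ) → ℝ}

theorem inv_smul_mem_levelSet (hP : HasMRVDensity P C α Q h lam) (hC : IsSupportCone C)
    {z : Fin d → ℝ} (hz : z ∈ C) (hz0 : z ≠ 0) {M : ℝ} (hM : 0 < M) :
    (((lam z / M) ^ α⁻¹)⁻¹ • z) ∈ levelSet C lam M := by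
  have hl := hP.lam_pos z hz hz0
  have hα := hP.index_pos
  refine ⟨hC.smul_mem (by positivity) hz, smul_ne_zero (by positivity) hz0, ?_⟩
  rw [hP.lam_smul hC hz hz0 (by positivity), Real.inv_rpow (by positivity),
    Real.rpow_inv_rpow (by positivity) hα.ne']
  field_simp

theorem measurableSet_superlevel (hP : HasMRVDensity P C α Q h lam) (hC : IsSupportCone C)
    (a : ℝ) : MeasurableSet {z | z ∈ C ∧ z ≠ 0 ∧ a ≤ lam z} := by
  have h1 := (hP.continuous_lam.preimage_isClosed_of_isClosed hC.isClosed
    (isClosed_Ici (a := a))).measurableSet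
  convert h1.inter (measurableSet_singleton (0 : Fin d → ℝ)).compl using 1
  ext z
  simp only [Set.mem_ofPred_eq, Set.mem_inter_iff, Set.mem_preimage, Set.mem_Ici,
    Set.mem_compl_iff, Set.mem_singleton_iff]
  tauto

/-- Write z = t w with w on the level set and t ≥ u. Then Q z ≥ (M-δ) q(t), the first δ being the
error of the limit. The second δ pays for an integrable factor (1+‖z‖)^(-(d+1)), since ‖z‖ ≤ B t and
log(1+Bt) is negligible against q(t). Finally q(t) ≥ q(u), usable because M - 2δ ≥ 0. -/
theorem exists_superlevel_le (hP : HasMRVDensity P C α Q h lam) (hC : IsSupportCone C)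
    {M δ : ℝ} (hδ : 0 < δ) (hδM : 2 * δ ≤ M) :
    ∃ K : ℝ≥0∞, K ≠ ∞ ∧ ∀ᶠ u in atTop, P {z | z ∈ C ∧ z ≠ 0 ∧ M * u ^ α ≤ lam z} ≤
      K * ENNReal.ofReal (Real.exp (-((M - 2 * δ) * (h u * u ^ α)))) := by
  have hM : 0 < M := by linarith
  have hα := hP.index_pos
  obtain ⟨B, hB0, hB⟩ := (hP.isCompact_levelSet hC hM).isBounded.exists_pos_norm_le
  obtain ⟨r, hr, hunif⟩ := hP.exists_uniform_ratio hC hM hδ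
  obtain ⟨u₀, hu₀, hmono, -⟩ := hP.eventually_increasing_continuous
  have hd : (0 : ℝ) < d + 1 := by positivity
  refine ⟨∫⁻ z : Fin d → ℝ, ENNReal.ofReal ((1 + ‖z‖) ^ (-(d + 1 : ℝ))),
    (finite_integral_one_add_norm (by simp)).ne, ?_⟩
  obtain ⟨U, hU⟩ := eventually_atTop.1 ((hunif.and hP.eventually_pos).and
    (hP.eventually_log_le hB0.le (by positivity : 0 < δ / (d + 1))))
  filter_upwards [eventually_ge_atTop U, eventually_ge_atTop u₀] with u huU huu
  have hu0 : 0 < u := hu₀.trans_le huu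
  rw [hP.density, withDensity_apply' _ _, ← lintegral_mul_const' _ _ ENNReal.ofReal_ne_top,
    ← lintegral_indicator (hP.measurableSet_superlevel hC _)]
  refine lintegral_mono fun z => ?_
  refine Set.indicator_apply_le' ?_ fun _ => zero_le
  rintro ⟨hz, hz0, hzl⟩
  rw [Set.indicator_of_mem hz, ← ENNReal.ofReal_mul (by positivity)]
  refine ENNReal.ofReal_le_ofReal ?_
  set t := (lam z / M) ^ α⁻¹ with ht
  have hlz := hP.lam_pos z hz hz0
  have ht0 : 0 < t := by positivity
  have hut : u ≤ t := by
    rw [ht, Real.le_rpow_inv_iff_of_pos hu0.le (by positivity) hα, le_div_iff₀ hM]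
    linarith
  have hw := hP.inv_smul_mem_levelSet hC hz hz0 hM
  rw [← ht] at hw
  obtain ⟨⟨hun, hqt⟩, hlog⟩ := hU t (huU.trans hut)
  have h1 := hun _ hw _ hw.1 (by simpa using hr)
  rw [smul_smul, mul_inv_cancel₀ ht0.ne', one_smul] at h1
  have h2 := (abs_lt.1 h1).1
  have hQ : (M - δ) * (h t * t ^ α) ≤ Q z := by
    rw [← le_div_iff₀ hqt]; linarith
  have hzn : ‖z‖ ≤ B * t := by
    have := hB _ hw
    rwa [norm_smul, norm_inv, Real.norm_of_nonneg ht0.le, inv_mul_le_iff₀ ht0, mul_comm] at this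
  have hlog' : (d + 1) * Real.log (1 + ‖z‖) ≤ δ * (h t * t ^ α) := by
    have h3 : Real.log (1 + ‖z‖) ≤ δ / (d + 1) * (h t * t ^ α) :=
      (Real.log_le_log (by positivity) (by linarith)).trans hlog
    rw [div_mul_eq_mul_div, le_div_iff₀ hd] at h3
    linarith
  have hq : h u * u ^ α ≤ h t * t ^ α := hmono huu (huu.trans hut) hut
  have hqu := (hU u huU).1.2
  rw [Real.rpow_def_of_pos (by positivity), ← Real.exp_add, Real.exp_le_exp]
  nlinarith [mul_le_mul_of_nonneg_left hq (sub_nonneg.2 hδM)]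

/-- After division by u, the cell around u w has diameter at most η/u < r, so Q ≤ (M+δ) q(u)
throughout it, while its volume stays η^d. -/
theorem eventually_le_gridCell (hP : HasMRVDensity P C α Q h lam) (hC : IsSupportCone C)
    {M δ η : ℝ} (hM : 0 < M) (hδ : 0 < δ) (hη : 0 < η) :
    ∀ᶠ u in atTop, ∀ w ∈ levelSet C lam M,
      ENNReal.ofReal (η ^ d * Real.exp (-((M + δ) * (h u * u ^ α)))) ≤
        P (gridCell η fun i => ⌊(u • w) i / η⌋) := by
  obtain ⟨r, hr, hunif⟩ := hP.exists_uniform_ratio hC hM hδ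
  filter_upwards [hunif, hP.eventually_pos, eventually_gt_atTop (η / r), eventually_gt_atTop 0]
    with u hun hq hur hu w hw
  set k : Fin d → ℤ := fun i => ⌊(u • w) i / η⌋
  have hkC : gridCell η k ⊆ C := hC.gridCell_floor_subset hη (hC.smul_mem hu.le hw.1)
  have hbd : ∀ y ∈ gridCell η k,
      ENNReal.ofReal (Real.exp (-((M + δ) * (h u * u ^ α)))) ≤
        C.indicator (fun z => ENNReal.ofReal (Real.exp (-Q z))) y := by
    intro y hy
    rw [Set.indicator_of_mem (hkC hy)]
    refine ENNReal.ofReal_le_ofReal (Real.exp_le_exp.2 (neg_le_neg ?_))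
    have hd : dist (u⁻¹ • y) w < r := by
      have h1 : dist y (u • w) ≤ η := dist_le_of_mem_gridCell hη hy (mem_gridCell_floor hη _)
      have h2 : w = u⁻¹ • (u • w) := by rw [smul_smul, inv_mul_cancel₀ hu.ne', one_smul]
      rw [h2, dist_smul₀, norm_inv, Real.norm_of_nonneg hu.le, inv_mul_lt_iff₀ hu]
      rw [div_lt_iff₀ hr] at hur
      linarith
    have h1 := hun w hw _ (hC.smul_mem (inv_nonneg.2 hu.le) (hkC hy)) hd
    rw [smul_smul, mul_inv_cancel₀ hu.ne', one_smul] at h1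
    have h2 := (abs_lt.1 h1).2
    rw [← div_le_iff₀ hq]
    linarith
  rw [hP.density, withDensity_apply _ (measurableSet_gridCell η k)]
  calc _ = ∫⁻ _ in gridCell η k, ENNReal.ofReal (Real.exp (-((M + δ) * (h u * u ^ α)))) := by
        rw [setLIntegral_const, volume_gridCell, mul_comm (η ^ d),
          ENNReal.ofReal_mul (by positivity), ENNReal.ofReal_pow hη.le]
    _ ≤ _ := setLIntegral_mono' (measurableSet_gridCell η k) hbd

end HasMRVDensity

/-! ### Borel–Cantelli for the samples -/

theorem summable_pow_mul_exp_neg_rpow {γ : ℝ} (hγ : 0 < γ) (d : ℕ) :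
    Summable fun N : ℕ => ((2 * N + 1 : ℕ) : ℝ) ^ d * Real.exp (-((N : ℝ) ^ γ)) := by
  -- The exponent is chosen so that N^γ raised to it is N^(-(d+2)), leaving N^(-2) after
  -- multiplication by N^d.
  have h1 := (isLittleO_exp_neg_mul_rpow_atTop one_pos (-((d + 2) / γ))).comp_tendsto
    ((tendsto_rpow_atTop hγ).comp tendsto_natCast_atTop_atTop)
  have h2 : (fun N : ℕ => ((2 * N + 1 : ℕ) : ℝ) ^ d) =O[atTop] fun N : ℕ => (N : ℝ) ^ d := by
    refine Asymptotics.IsBigO.of_bound (3 ^ d) ?_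
    filter_upwards [eventually_ge_atTop 1] with N hN
    rw [Real.norm_of_nonneg (by positivity), Real.norm_of_nonneg (by positivity), ← mul_pow]
    gcongr
    push_cast
    have : (1 : ℝ) ≤ N := by exact_mod_cast hN
    linarith
  have h3 := h2.mul h1.isBigO
  refine summable_of_isBigO_nat (Real.summable_nat_rpow.2 (by norm_num : (-2 : ℝ) < -1)) ?_
  refine (h3.congr_left fun N => by simp [Function.comp]).trans_eventuallyEq ?_
  filter_upwards [eventually_ge_atTop 1] with N hN
  have hN0 : (0 : ℝ) < N := by exact_mod_cast hN
  simp only [Function.comp]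
  rw [← Real.rpow_mul hN0.le, ← Real.rpow_natCast, ← Real.rpow_add hN0]
  congr 1
  field_simp
  ring

section Samples

variable {E Ω : Type*} [MeasurableSpace E] [MeasurableSpace Ω] {μ : Measure Ω}

theorem measure_forall_notMem_le {P : Measure E} [IsProbabilityMeasure P] {N : ℕ}
    {ξ : Fin N → Ω → E} (hξm : ∀ j, Measurable (ξ j)) (hξi : iIndepFun ξ μ)
    (hξP : ∀ j, μ.map (ξ j) = P) {s : Set E} (hs : MeasurableSet s) {p : ℝ} (hp0 : 0 ≤ p)
    (hp : ENNReal.ofReal p ≤ P s) :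
    μ {ω | ∀ j, ξ j ω ∉ s} ≤ ENNReal.ofReal (Real.exp (-(N * p))) := by
  have h1 : {ω | ∀ j, ξ j ω ∉ s} = ⋂ j ∈ Finset.univ, ξ j ⁻¹' sᶜ := by
    ext ω; simp
  rw [h1, hξi.measure_inter_preimage_eq_mul Finset.univ fun _ _ => hs.compl]
  have h2 : ∀ j, μ (ξ j ⁻¹' sᶜ) ≤ ENNReal.ofReal (Real.exp (-p)) := by
    intro j
    rw [← Measure.map_apply (hξm j) hs.compl, hξP j, prob_compl_eq_one_sub hs]
    calc 1 - P s ≤ 1 - ENNReal.ofReal p := by gcongr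
      _ = ENNReal.ofReal (1 - p) := by rw [ENNReal.ofReal_sub _ hp0, ENNReal.ofReal_one]
      _ ≤ _ := ENNReal.ofReal_le_ofReal (by linarith [Real.add_one_le_exp (-p)])
  calc _ ≤ ∏ _j : Fin N, ENNReal.ofReal (Real.exp (-p)) := Finset.prod_le_prod' fun j _ => h2 j
    _ = _ := by
      rw [Finset.prod_const, Finset.card_univ, Fintype.card_fin,
        ← ENNReal.ofReal_pow (by positivity), ← Real.exp_nat_mul]
      congr 2; ring

/-- A union bound over at most (2N+1)^d cells, each missed with probability at most exp(-N ·
N^(γ-1)), is summable in N. The first Borel–Cantelli lemma needs no independence across different N,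
so their joint law is irrelevant. -/
theorem ae_eventually_gridCell_hit {d : ℕ} {P : Measure (Fin d → ℝ)} [IsProbabilityMeasure P]
    {ξ : (N : ℕ) → Fin N → Ω → Fin d → ℝ} (hξm : ∀ N j, Measurable (ξ N j))
    (hξi : ∀ N, iIndepFun (ξ N) μ) (hξP : ∀ N j, μ.map (ξ N j) = P) (η : ℝ) {γ : ℝ} (hγ : 0 < γ) :
    ∀ᵐ ω ∂μ, ∀ᶠ N : ℕ in atTop, ∀ k : Fin d → ℤ, (∀ i, |k i| ≤ N) →
      ENNReal.ofReal ((N : ℝ) ^ (γ - 1)) ≤ P (gridCell η k) → ∃ j, ξ N j ω ∈ gridCell η k := by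
  let K : ℕ → Finset (Fin d → ℤ) := fun N =>
    (Fintype.piFinset fun _ : Fin d => Finset.Icc (-(N : ℤ)) N).filter
      fun k => ENNReal.ofReal ((N : ℝ) ^ (γ - 1)) ≤ P (gridCell η k)
  let bad : ℕ → Set Ω := fun N => ⋃ k ∈ K N, {ω | ∀ j, ξ N j ω ∉ gridCell η k}
  have hbad : ∀ N : ℕ, μ (bad N) ≤
      ENNReal.ofReal (((2 * N + 1 : ℕ) : ℝ) ^ d * Real.exp (-((N : ℝ) ^ γ))) := by
    intro N
    have hcard : (K N).card ≤ (2 * N + 1) ^ d := by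
      refine (Finset.card_filter_le _ _).trans ?_
      rw [Fintype.card_piFinset_const, Int.card_Icc]
      exact Nat.pow_le_pow_left (by omega) d
    have hone : ∀ k ∈ K N, μ {ω | ∀ j, ξ N j ω ∉ gridCell η k} ≤
        ENNReal.ofReal (Real.exp (-((N : ℝ) ^ γ))) := by
      intro k hk
      refine (measure_forall_notMem_le (hξm N) (hξi N) (hξP N) (measurableSet_gridCell η k)
        (by positivity) (Finset.mem_filter.1 hk).2).trans (ENNReal.ofReal_le_ofReal ?_)
      rw [Real.exp_le_exp, neg_le_neg_iff]
      rcases N.eq_zero_or_pos with rfl | hN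
      · simp [hγ.ne']
      · have hN0 : (0 : ℝ) < N := by exact_mod_cast hN
        rw [Real.rpow_sub_one hN0.ne', mul_div_cancel₀ _ hN0.ne']
    calc μ (bad N) ≤ ∑ k ∈ K N, μ {ω | ∀ j, ξ N j ω ∉ gridCell η k} :=
          measure_biUnion_finset_le _ _
      _ ≤ (K N).card • ENNReal.ofReal (Real.exp (-((N : ℝ) ^ γ))) :=
          Finset.sum_le_card_nsmul _ _ _ hone
      _ ≤ _ := by
          rw [ENNReal.ofReal_mul (by positivity), nsmul_eq_mul,
            ENNReal.ofReal_pow (by positivity), ENNReal.ofReal_natCast]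
          gcongr
          exact_mod_cast hcard
  have hsum : ∑' N, μ (bad N) ≠ ∞ :=
    ne_top_of_le_ne_top (summable_pow_mul_exp_neg_rpow hγ d).tsum_ofReal_ne_top
      (ENNReal.tsum_le_tsum hbad)
  filter_upwards [ae_eventually_notMem hsum] with ω hω
  filter_upwards [hω] with N hN k hk hPk
  by_contra! hcon
  refine hN (Set.mem_iUnion₂.2 ⟨k, ?_, hcon⟩)
  refine Finset.mem_filter.2 ⟨Fintype.mem_piFinset.2 fun i => ?_, hPk⟩
  exact Finset.mem_Icc.2 (abs_le.1 (hk i))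

end Samples

/-! ### From hit cells to a bound on the violation probability -/

theorem exists_dotProduct_mulVec_le {n d m : ℕ} {X : Set (Fin n → ℝ)} (hX : Bornology.IsBounded X)
    (A : Fin m → Matrix (Fin n) (Fin d) ℝ) :
    ∃ R > 0, ∀ x ∈ X, ∀ i v, x ⬝ᵥ (A i *ᵥ v) ≤ R * ‖v‖ := by
  obtain ⟨B, hB0, hB⟩ := hX.exists_pos_norm_le
  refine ⟨1 + ∑ i, ∑ k, B * ∑ l, |A i k l|, by positivity, fun x hx i v => ?_⟩
  have h1 : x ⬝ᵥ (A i *ᵥ v) ≤ (∑ k, B * ∑ l, |A i k l|) * ‖v‖ := by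
    rw [dotProduct, Finset.sum_mul]
    refine Finset.sum_le_sum fun k _ => ?_
    refine (le_abs_self _).trans ?_
    rw [abs_mul, mul_assoc]
    have hxk : |x k| ≤ B := (norm_le_pi_norm x k).trans (hB x hx)
    refine mul_le_mul hxk ?_ (abs_nonneg _) hB0.le
    rw [Matrix.mulVec, dotProduct, Finset.sum_mul]
    refine (Finset.abs_sum_le_sum_abs _ _).trans (Finset.sum_le_sum fun l _ => ?_)
    rw [abs_mul]
    exact mul_le_mul_of_nonneg_left (norm_le_pi_norm v l) (abs_nonneg _)
  refine h1.trans (mul_le_mul_of_nonneg_right ?_ (norm_nonneg v))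
  have h2 : ∑ k, B * ∑ l, |A i k l| ≤ ∑ i, ∑ k, B * ∑ l, |A i k l| :=
    Finset.single_le_sum (f := fun i => ∑ k, B * ∑ l, |A i k l|)
      (fun i _ => by positivity) (Finset.mem_univ i)
  linarith

theorem eventually_exists_eq_of_continuousOn {q : ℝ → ℝ} {u₀ : ℝ}
    (hq : ContinuousOn q (Set.Ici u₀)) (hlim : Tendsto q atTop atTop) {p : ℝ → Prop}
    (hp : ∀ᶠ u in atTop, p u) : ∀ᶠ y in atTop, ∃ u, p u ∧ q u = y := by
  obtain ⟨U, hU⟩ := eventually_atTop.1 (hp.and (eventually_ge_atTop u₀))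
  filter_upwards [eventually_ge_atTop (q U)] with y hy
  obtain ⟨b, hb, hyb⟩ := ((eventually_ge_atTop U).and (hlim.eventually_ge_atTop y)).exists
  obtain ⟨u, hu, rfl⟩ := intermediate_value_Icc hb
    (hq.mono fun v hv => (hU U le_rfl).2.trans hv.1) ⟨hy, hyb⟩
  exact ⟨u, (hU u hu.1).1, rfl⟩

theorem exists_margin {s α ρ : ℝ} (hs : 0 < s) (hρ : ρ < s ^ α) :
    ∃ τ ∈ Set.Ioo (0 : ℝ) 1, 2 * τ ≤ (1 - τ) / (1 / s + τ) ^ α ∧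
      ρ < (1 - τ) / (1 / s + τ) ^ α - 2 * τ := by
  have h0 : ContinuousAt (fun τ : ℝ => (1 - τ) / (1 / s + τ) ^ α - 2 * τ) 0 := by
    have h1 : ContinuousAt (fun τ : ℝ => (1 / s + τ) ^ α) 0 :=
      (continuousAt_const.add continuousAt_id).rpow_const (Or.inl (by simpa using hs.ne'))
    refine ((continuousAt_const.sub continuousAt_id).div h1 ?_).sub
      (continuousAt_const.mul continuousAt_id)
    simp only [add_zero]
    positivity
  have hlim : Tendsto (fun τ : ℝ => (1 - τ) / (1 / s + τ) ^ α - 2 * τ) (𝓝[>] 0) (𝓝 (s ^ α)) := by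
    have := h0.tendsto
    simp only [sub_zero, add_zero, mul_zero, one_div, Real.inv_rpow hs.le, inv_inv] at this
    exact (by simpa only [one_div] using this : Tendsto _ _ _).mono_left nhdsWithin_le_nhds
  -- Comparing with max ρ 0 also secures 2τ ≤ M when ρ is negative.
  obtain ⟨τ, h1, h2⟩ := ((hlim.eventually (lt_mem_nhds (max_lt hρ (by positivity : 0 < s ^ α)))).and
    (Ioo_mem_nhdsGT one_pos)).exists
  exact ⟨τ, h2, by linarith [(le_max_right ρ 0).trans_lt h1], (le_max_left _ _).trans_lt h1⟩

/-- The samples `ξ` meet every grid cell of side `η` with index in `[-N, N]^d` whose probability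
is at least `N ^ (η - 1)`. -/
def HitsCells {d N : ℕ} (P : Measure (Fin d → ℝ)) (η : ℝ) (ξ : Fin N → Fin d → ℝ) : Prop :=
  ∀ k : Fin d → ℤ, (∀ i, |k i| ≤ N) →
    ENNReal.ofReal ((N : ℝ) ^ (η - 1)) ≤ P (gridCell η k) → ∃ j, ξ j ∈ gridCell η k

namespace HasMRVDensity

variable {n d m : ℕ} {P : Measure (Fin d → ℝ)} {C : Set (Fin d → ℝ)} {α : ℝ}
    {Q : (Fin d → ℝ) → ℝ} {h : ℝ → ℝ} {lam : (Fin d → ℝ) → ℝ}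

theorem ae_mem (hP : HasMRVDensity P C α Q h lam) (hC : IsSupportCone C) : ∀ᵐ z ∂P, z ∈ C := by
  rw [hP.density, ae_withDensity_iff']
  · refine Eventually.of_forall fun z hz => ?_
    by_contra hzC
    exact hz (Set.indicator_of_notMem hzC _)
  · exact ((hP.measurable_Q.neg.exp.ennreal_ofReal).indicator hC.isClosed.measurableSet).aemeasurable

theorem violation_le_superlevel (hP : HasMRVDensity P C α Q h lam) (hC : IsSupportCone C)
    (A : Fin m → Matrix (Fin n) (Fin d) ℝ) {x : Fin n → ℝ} {s τ η R B u : ℝ} {N : ℕ}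
    {ξ : Fin N → Fin d → ℝ} (hs : 0 < s) (hτ : τ ∈ Set.Ioo (0 : ℝ) 1) (hη : 0 < η)
    (hRη : R * η ≤ τ) (hR0 : 0 < R) (hR : ∀ i v, x ⬝ᵥ (A i *ᵥ v) ≤ R * ‖v‖)
    (hB : ∀ w ∈ levelSet C lam (1 - τ), ‖w‖ ≤ B) (hu : 0 < u) (hBN : 1 + B / η * u ≤ N)
    (hcell : ∀ w ∈ levelSet C lam (1 - τ), ENNReal.ofReal ((N : ℝ) ^ (η - 1)) ≤
      P (gridCell η fun i => ⌊(u • w) i / η⌋))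
    (hhit : HitsCells P η ξ) (hx : ∀ j i, x ⬝ᵥ (A i *ᵥ ξ j) ≤ 1 / s) :
    violation A P x ≤
      P {z | z ∈ C ∧ z ≠ 0 ∧ (1 - τ) / (1 / s + τ) ^ α * u ^ α ≤ lam z} := by
  refine measure_mono_ae ?_
  filter_upwards [hP.ae_mem hC] with z hz
  rintro ⟨i, hi⟩
  have hz0 : z ≠ 0 := by
    rintro rfl
    simp at hi
    linarith
  refine ⟨hz, hz0, ?_⟩
  by_contra! hlt
  have hτ1 : 0 < 1 - τ := by linarith [hτ.2]
  have hτ0 := hτ.1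
  have hα := hP.index_pos
  have hl := hP.lam_pos z hz hz0
  have hσ : 0 < 1 / s + τ := by positivity
  have hv := hP.inv_smul_mem_levelSet hC hz hz0 hτ1
  set c := (lam z / (1 - τ)) ^ α⁻¹ with hc
  have hc0 : 0 < c := by positivity
  have hcu : c < u / (1 / s + τ) := by
    rw [hc, Real.rpow_inv_lt_iff_of_pos (by positivity) (by positivity) hα, div_lt_iff₀ hτ1,
      Real.div_rpow hu.le hσ.le]
    calc _ < _ := hlt
      _ = _ := by ring
  set w := c⁻¹ • z with hw
  -- The indices lie in [-N, N]; the 1 in `hBN` absorbs the rounding of the floor.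
  obtain ⟨j, hj⟩ := hhit (fun i => ⌊(u • w) i / η⌋) (fun l => by
      have h1 : |(u • w) l / η| ≤ B / η * u := by
        rw [abs_div, abs_of_pos hη, Pi.smul_apply, smul_eq_mul, abs_mul, abs_of_pos hu,
          div_mul_eq_mul_div, mul_comm u]
        gcongr
        exact (norm_le_pi_norm w l).trans (hB w hv)
      have h2 := abs_le.1 h1
      have h3 := Int.floor_le ((u • w) l / η)
      have h4 := Int.lt_floor_add_one ((u • w) l / η)
      rw [abs_le]
      constructor
      · have : (-(N : ℝ)) ≤ ⌊(u • w) l / η⌋ := by linarith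
        exact_mod_cast this
      · have : (⌊(u • w) l / η⌋ : ℝ) ≤ N := by linarith
        exact_mod_cast this) (hcell w hv)
  have hd : ‖u • w - ξ j‖ ≤ η := by
    rw [← dist_eq_norm]
    exact dist_le_of_mem_gridCell hη (mem_gridCell_floor hη _) hj
  have h1 := hR i (u • w - ξ j)
  rw [Matrix.mulVec_sub, dotProduct_sub, hw, smul_smul, Matrix.mulVec_smul, dotProduct_smul,
    smul_eq_mul] at h1
  have h2 := hx j i
  have h3 : R * ‖u • w - ξ j‖ ≤ R * η := by gcongr
  rw [hw, smul_smul] at h3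
  -- The contradiction: the sample near u w forces xᵀA⁽ⁱ⁾(uw) ≤ 1/s + τ, yet this value is (u/c)
  -- xᵀA⁽ⁱ⁾z > u/c.
  have h4 : 1 / s + τ < u * c⁻¹ := by
    rw [← div_eq_mul_inv, lt_div_iff₀ hc0]
    rw [lt_div_iff₀ hσ] at hcu
    linarith
  have h5 : u * c⁻¹ < u * c⁻¹ * (x ⬝ᵥ A i *ᵥ z) := lt_mul_of_one_lt_right (by positivity) hi
  linarith

theorem exists_eventually_violation_le (hP : HasMRVDensity P C α Q h lam) (hC : IsSupportCone C)
    {X : Set (Fin n → ℝ)} (hX : Bornology.IsBounded X) (A : Fin m → Matrix (Fin n) (Fin d) ℝ)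
    {s ρ : ℝ} (hs : 0 < s) (hρ : ρ < s ^ α) :
    ∃ p : ℕ, ∀ᶠ N : ℕ in atTop, ∀ ξ : Fin N → Fin d → ℝ, HitsCells P (1 / (p + 1 : ℝ)) ξ →
      ∀ x, Feasible X A s ξ x → violation A P x ≤ ENNReal.ofReal ((N : ℝ) ^ (-ρ)) := by
  obtain ⟨τ, hτ, hτM, hρM⟩ := exists_margin hs hρ
  set M := (1 - τ) / (1 / s + τ) ^ α
  obtain ⟨R, hR0, hR⟩ := exists_dotProduct_mulVec_le hX A
  have hτ0 := hτ.1
  have hτ1 : 0 < 1 - τ := by linarith [hτ.2]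
  -- η serves both as mesh and as exponent slack. Taking it of the form 1/(p+1) leaves only
  -- countably many almost sure events to intersect.
  obtain ⟨p, hp⟩ := exists_nat_one_div_lt (lt_min (half_pos hτ0) (div_pos hτ0 hR0))
  set η : ℝ := 1 / (p + 1 : ℝ)
  have hη : 0 < η := by positivity
  have hητ : η < τ / 2 := hp.trans_le (min_le_left _ _)
  have hRη : R * η ≤ τ := by
    have := (hp.trans_le (min_le_right _ _)).le
    rw [le_div_iff₀ hR0] at this
    linarith
  obtain ⟨B, hB0, hB⟩ := (hP.isCompact_levelSet hC hτ1).isBounded.exists_pos_norm_le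
  obtain ⟨K, hK, htail⟩ := hP.exists_superlevel_le hC hτ0 hτM
  obtain ⟨u₀, -, -, hcont⟩ := hP.eventually_increasing_continuous
  -- Continuity of q lets the scale u solve q(u) = log N exactly, turning exponentials of q(u) into
  -- powers of N.
  have hev := eventually_exists_eq_of_continuousOn hcont hP.tendsto_atTop
    (((htail.and (hP.eventually_le_gridCell hC hτ1 (half_pos hτ0) hη)).and
      (hP.eventually_log_le (by positivity : 0 ≤ B / η) one_pos)).and (eventually_gt_atTop 0))
  have hK' : ∀ᶠ N : ℕ in atTop, K.toReal ≤ (N : ℝ) ^ (M - 2 * τ - ρ) :=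
    ((tendsto_rpow_atTop (by linarith : 0 < M - 2 * τ - ρ)).comp
      tendsto_natCast_atTop_atTop).eventually_ge_atTop _
  -- Since η < τ/2, this spare power of N absorbs the cell volume η^d.
  have hη' : ∀ᶠ N : ℕ in atTop, (η ^ d)⁻¹ ≤ (N : ℝ) ^ (τ / 2 - η) :=
    ((tendsto_rpow_atTop (by linarith : 0 < τ / 2 - η)).comp
      tendsto_natCast_atTop_atTop).eventually_ge_atTop _
  refine ⟨p, ?_⟩
  filter_upwards [(Real.tendsto_log_atTop.comp tendsto_natCast_atTop_atTop).eventually hev,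
    hK', hη', eventually_ge_atTop 1] with N hN hKN hηN hN1 ξ hhit x hx
  obtain ⟨u, ⟨⟨⟨htl, hcl⟩, hlog⟩, hu⟩, huN⟩ := hN
  have hN0 : (0 : ℝ) < N := by exact_mod_cast hN1
  simp only [Function.comp] at huN
  have hexp : ∀ a : ℝ, Real.exp (-(a * (h u * u ^ α))) = (N : ℝ) ^ (-a) := by
    intro a
    rw [huN, Real.rpow_def_of_pos hN0]
    congr 1; ring
  have hBN : 1 + B / η * u ≤ N := by
    rwa [one_mul, huN, Real.log_le_log_iff (by positivity) hN0] at hlog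
  have hcell : ∀ w ∈ levelSet C lam (1 - τ), ENNReal.ofReal ((N : ℝ) ^ (η - 1)) ≤
      P (gridCell η fun i => ⌊(u • w) i / η⌋) := by
    intro w hw
    refine le_trans (ENNReal.ofReal_le_ofReal ?_) (hcl w hw)
    rw [hexp]
    have h1 : (N : ℝ) ^ (-(1 - τ + τ / 2)) = (N : ℝ) ^ (τ / 2 - η) * (N : ℝ) ^ (η - 1) := by
      rw [← Real.rpow_add hN0]; congr 1; ring
    rw [h1, ← mul_assoc]
    refine le_mul_of_one_le_left (by positivity) ?_
    rwa [inv_le_iff_one_le_mul₀' (by positivity)] at hηN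
  refine (hP.violation_le_superlevel hC A hs hτ hη hRη hR0 (hR x hx.1) hB hu hBN hcell hhit
    hx.2).trans (htl.trans ?_)
  rw [hexp, ← ENNReal.ofReal_toReal hK, ← ENNReal.ofReal_mul ENNReal.toReal_nonneg]
  refine ENNReal.ofReal_le_ofReal ?_
  calc _ ≤ (N : ℝ) ^ (M - 2 * τ - ρ) * (N : ℝ) ^ (-(M - 2 * τ)) := by gcongr
    _ = _ := by rw [← Real.rpow_add hN0]; congr 1; ring

end HasMRVDensity

/-! ### Asymptotics of the sample size and conversion from N to ε -/

theorem log_one_div_add_pos (n : ℕ) {β : ℝ} (hβ : β ∈ Set.Ioo (0 : ℝ) 1) :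
    0 < Real.log (1 / β) + n := by
  have h1 : 0 < Real.log (1 / β) := Real.log_pos (by rw [lt_div_iff₀ hβ.1]; linarith [hβ.2])
  positivity

theorem tendsto_sampleSize_atTop (n : ℕ) {β : ℝ} (hβ : β ∈ Set.Ioo (0 : ℝ) 1) :
    Tendsto (fun ε : ℝ => sampleSize n ε β) (𝓝[>] 0) atTop := by
  refine tendsto_nat_ceil_atTop.comp (Tendsto.atTop_mul_const (log_one_div_add_pos n hβ) ?_)
  exact tendsto_inv_nhdsGT_zero.const_mul_atTop two_pos

theorem tendsto_rpow_nhdsGT_zero {κ : ℝ} (hκ : 0 < κ) :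
    Tendsto (fun ε : ℝ => ε ^ κ) (𝓝[>] 0) (𝓝[>] 0) := by
  refine tendsto_nhdsWithin_iff.2 ⟨?_, ?_⟩
  · have := (Real.continuousAt_rpow_const 0 κ (Or.inr hκ.le)).tendsto
    rw [Real.zero_rpow hκ.ne'] at this
    exact this.mono_left nhdsWithin_le_nhds
  · filter_upwards [self_mem_nhdsWithin] with ε hε
    exact Real.rpow_pos_of_pos hε κ

/-- For ε < 1 the ceiling lies between 2c/ε and (2c+1)/ε, so its logarithm is -log ε up to a bounded
term. -/
theorem tendsto_log_sampleSize_div_neg_log (n : ℕ) {β : ℝ} (hβ : β ∈ Set.Ioo (0 : ℝ) 1) :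
    Tendsto (fun ε : ℝ => Real.log (sampleSize n ε β) / -Real.log ε) (𝓝[>] 0) (𝓝 1) := by
  set c := Real.log (1 / β) + n with hc
  have hc0 : 0 < c := log_one_div_add_pos n hβ
  have hneg : Tendsto (fun ε : ℝ => -Real.log ε) (𝓝[>] 0) atTop :=
    tendsto_neg_atBot_atTop.comp Real.tendsto_log_nhdsGT_zero
  have hlim : ∀ b : ℝ, Tendsto (fun ε : ℝ => b / -Real.log ε + 1) (𝓝[>] 0) (𝓝 1) := fun b => by
    simpa using (hneg.const_div_atTop b).add_const 1
  refine tendsto_of_tendsto_of_tendsto_of_le_of_le' (hlim (Real.log (2 * c)))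
    (hlim (Real.log (2 * c + 1))) ?_ ?_ <;>
  filter_upwards [Ioo_mem_nhdsGT (one_pos : (0 : ℝ) < 1)] with ε hε
  all_goals
    have hε0 := hε.1
    have hl : 0 < -Real.log ε := neg_pos.2 (Real.log_neg hε.1 hε.2)
    have hx : 2 / ε * c = 2 * c / ε := by ring
    rw [div_add_one hl.ne']
    refine div_le_div_of_nonneg_right ?_ hl.le
    rw [← sub_eq_add_neg, ← Real.log_div (by positivity) hε0.ne']
  · refine Real.log_le_log (by positivity) ?_
    rw [← hx]
    exact Nat.le_ceil _
  · have h1 : (0 : ℝ) < sampleSize n ε β := by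
      exact_mod_cast Nat.ceil_pos.2 (by positivity)
    refine Real.log_le_log h1 ?_
    have h2 := (Nat.ceil_lt_add_one (by positivity : 0 ≤ 2 / ε * c)).le
    refine h2.trans ?_
    rw [hx, add_div]
    gcongr
    rw [le_div_iff₀ hε0]
    linarith [hε.2]

theorem tendsto_log_sampleSize_ratio (n : ℕ) {β κ : ℝ} (hβ : β ∈ Set.Ioo (0 : ℝ) 1)
    (hκ : 0 < κ) :
    Tendsto (fun ε : ℝ => Real.log (sampleSize n (ε ^ κ) β) / Real.log (sampleSize n ε β))
      (𝓝[>] 0) (𝓝 κ) := by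
  have h1 := tendsto_log_sampleSize_div_neg_log n hβ
  have h2 := ((h1.comp (tendsto_rpow_nhdsGT_zero hκ)).div h1 one_ne_zero).const_mul κ
  rw [div_one, mul_one] at h2
  refine h2.congr' ?_
  filter_upwards [Ioo_mem_nhdsGT (one_pos : (0 : ℝ) < 1)] with ε hε
  have hl : -Real.log ε ≠ 0 := (neg_pos.2 (Real.log_neg hε.1 hε.2)).ne'
  simp only [Function.comp, Pi.div_apply]
  rw [Real.log_rpow hε.1, ← mul_neg, div_mul_eq_div_div, div_div_div_cancel_right₀ hl,
    div_right_comm, mul_div_cancel₀ _ hκ.ne']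

theorem one_le_liminf_log_div_log {V : ℝ → ℝ≥0∞}
    (hV : ∀ δ : ℝ, 0 < δ → ∀ᶠ ε in 𝓝[>] (0 : ℝ), V ε ≤ ENNReal.ofReal (ε ^ (1 - δ))) :
    1 ≤ liminf (fun ε : ℝ => ENNReal.log (V ε) / ((Real.log ε : ℝ) : EReal)) (𝓝[>] (0 : ℝ)) := by
  refine le_of_forall_lt_imp_le_of_dense fun a ha => ?_
  obtain ⟨r, har, hr1⟩ := EReal.lt_iff_exists_real_btwn.1 ha
  have hr1' : r < 1 := by exact_mod_cast hr1
  refine har.le.trans (le_liminf_of_le (by isBoundedDefault) ?_)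
  filter_upwards [hV (1 - r) (by linarith), Ioo_mem_nhdsGT (one_pos : (0 : ℝ) < 1)] with ε hε hε1
  rw [sub_sub_cancel] at hε
  have hl : Real.log ε < 0 := Real.log_neg hε1.1 hε1.2
  have h1 := ENNReal.log_le_log hε
  rw [ENNReal.log_ofReal_of_pos (Real.rpow_pos_of_pos hε1.1 r), Real.log_rpow hε1.1] at h1
  -- Dividing by log ε < 0 reverses the inequality; the case V = 0 is included, as its logarithm is
  -- ⊥.
  have h2 := EReal.div_le_div_right_of_nonpos (c := (Real.log ε : EReal))
    (by exact_mod_cast hl.le) h1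
  rwa [← EReal.coe_div, mul_div_cancel_right₀ r hl.ne] at h2

theorem eventually_violation_le_rpow {n d m : ℕ} {P : Measure (Fin d → ℝ)}
    (A : Fin m → Matrix (Fin n) (Fin d) ℝ) {s α β : ℝ} (hs : 0 < s)
    (hβ : β ∈ Set.Ioo (0 : ℝ) 1) {F : (N : ℕ) → Set (Fin n → ℝ)}
    (hF : ∀ ρ < s ^ α, ∀ᶠ N : ℕ in atTop, ∀ x ∈ F N,
      violation A P x ≤ ENNReal.ofReal ((N : ℝ) ^ (-ρ)))
    {N : ℝ → ℕ} {x : ℝ → Fin n → ℝ}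
    (hNx : ∀ᶠ ε in 𝓝[>] (0 : ℝ), sampleSize n (ε ^ (s ^ (-α))) β ≤ N ε ∧ x ε ∈ F (N ε))
    {δ : ℝ} (hδ : 0 < δ) :
    ∀ᶠ ε in 𝓝[>] (0 : ℝ), violation A P (x ε) ≤ ENNReal.ofReal (ε ^ (1 - δ)) := by
  set c := Real.log (1 / β) + n with hc
  have hc0 : 0 < c := log_one_div_add_pos n hβ
  have hsα : 0 < s ^ α := by positivity
  have hκ : 0 < s ^ (-α) := by positivity
  -- γ < 1 keeps ρ positive; γ < δ leaves a factor ε^(δ-γ) that swallows the constant (2c)^(-ρ).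
  obtain ⟨γ, hγ0, hγδ, hγ1⟩ : ∃ γ, 0 < γ ∧ γ < δ ∧ γ < 1 :=
    ⟨min δ 1 / 2, by positivity, by linarith [min_le_left δ 1, lt_min hδ one_pos],
      by linarith [min_le_right δ 1]⟩
  set ρ := (1 - γ) * s ^ α with hρ
  have hρ0 : 0 < ρ := mul_pos (by linarith) hsα
  have hρs : ρ < s ^ α := by rw [hρ]; nlinarith
  have hNlim : Tendsto N (𝓝[>] (0 : ℝ)) atTop :=
    tendsto_atTop_mono' _ (hNx.mono fun ε h => h.1)
      ((tendsto_sampleSize_atTop n hβ).comp (tendsto_rpow_nhdsGT_zero hκ))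
  have hsmall : ∀ᶠ ε in 𝓝[>] (0 : ℝ), ε ^ (δ - γ) < (2 * c) ^ ρ :=
    ((tendsto_rpow_nhdsGT_zero (sub_pos.2 hγδ)).mono_right nhdsWithin_le_nhds).eventually
      (gt_mem_nhds (by positivity))
  filter_upwards [hNx, hNlim.eventually (hF ρ hρs), hsmall, self_mem_nhdsWithin]
    with ε hNε hVε hε (hε0 : 0 < ε)
  refine (hVε _ hNε.2).trans (ENNReal.ofReal_le_ofReal ?_)
  have h1 : 2 * c * ε ^ (-s ^ (-α)) ≤ N ε := by
    have h2 : 2 / ε ^ s ^ (-α) * c ≤ N ε := (Nat.le_ceil _).trans (by exact_mod_cast hNε.1)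
    rw [Real.rpow_neg hε0.le]
    calc _ = _ := by ring
      _ ≤ _ := h2
  have h3 : -s ^ (-α) * -ρ = 1 - γ := by
    rw [hρ, Real.rpow_neg hs.le]
    field_simp
  calc ((N ε : ℕ) : ℝ) ^ (-ρ) ≤ (2 * c * ε ^ (-s ^ (-α))) ^ (-ρ) :=
        Real.rpow_le_rpow_of_nonpos (by positivity) h1 (by linarith)
    _ = ((2 * c) ^ ρ)⁻¹ * ε ^ (1 - γ) := by
        rw [Real.mul_rpow (by positivity) (by positivity), ← Real.rpow_mul hε0.le, h3,
          Real.rpow_neg (by positivity)]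
    _ = ((2 * c) ^ ρ)⁻¹ * ε ^ (δ - γ) * ε ^ (1 - δ) := by
        rw [mul_assoc, ← Real.rpow_add hε0]; congr 2; ring
    _ ≤ 1 * ε ^ (1 - δ) := by
        gcongr
        rw [inv_mul_le_iff₀ (by positivity), mul_one]
        exact hε.le
    _ = _ := one_mul _

end ScaledScenario

theorem theorem1 {n d m : ℕ} (X : Set (Fin n → ℝ)) (hXc : IsCompact X) (hXv : Convex ℝ X)
    (A : Fin m → Matrix (Fin n) (Fin d) ℝ)
    (P : Measure (Fin d → ℝ)) [IsProbabilityMeasure P]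
    (C : Set (Fin d → ℝ)) (hC : ScaledScenario.IsSupportCone C)
    (α : ℝ) (Q : (Fin d → ℝ) → ℝ) (h : ℝ → ℝ) (lam : (Fin d → ℝ) → ℝ)
    (hP : ScaledScenario.HasMRVDensity P C α Q h lam)
    (s : ℝ) (hs : 1 ≤ s) (β : ℝ) (hβ : β ∈ Set.Ioo (0 : ℝ) 1)
    {Ω : Type*} [MeasurableSpace Ω] (μ : Measure Ω) [IsProbabilityMeasure μ]
    -- for every `N`, the `N` samples that define the scaled sampled problem are i.i.d. from `P`
    (ξ : (N : ℕ) → Fin N → Ω → Fin d → ℝ)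
    (hξm : ∀ N j, Measurable (ξ N j))
    (hξi : ∀ N, iIndepFun (ξ N) μ)
    (hξP : ∀ N j, μ.map (ξ N j) = P) :
    (∃ S : Set Ω, MeasurableSet S ∧ ENNReal.ofReal (1 - β) ≤ μ S ∧
      ∀ ω ∈ S, ∀ (N : ℝ → ℕ) (x : ℝ → Fin n → ℝ),
        (∀ᶠ ε in 𝓝[>] (0 : ℝ), ScaledScenario.sampleSize n (ε ^ (s ^ (-α))) β ≤ N ε ∧
          ScaledScenario.Feasible X A s (fun j => ξ (N ε) j ω) (x ε)) →
        1 ≤ liminf (fun ε : ℝ => ENNReal.log (ScaledScenario.violation A P (x ε)) /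
            ((Real.log ε : ℝ) : EReal)) (𝓝[>] (0 : ℝ)) ∧
        ∀ δ : ℝ, 0 < δ → ∀ᶠ ε in 𝓝[>] (0 : ℝ),
          ScaledScenario.violation A P (x ε) ≤ ENNReal.ofReal (ε ^ (1 - δ))) ∧
    Tendsto (fun ε : ℝ => Real.log (ScaledScenario.sampleSize n (ε ^ (s ^ (-α))) β) /
        Real.log (ScaledScenario.sampleSize n ε β)) (𝓝[>] (0 : ℝ)) (𝓝 (1 / s ^ α)) := by
  have hs0 : 0 < s := by linarith
  refine ⟨?_, ?_⟩
  -- One event serves all meshes 1/(p+1), hence all δ and all sample-dependent choices of N and x.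
  · have hae : ∀ᵐ ω ∂μ, ∀ p : ℕ, ∀ᶠ N : ℕ in atTop,
        ScaledScenario.HitsCells P (1 / (p + 1 : ℝ)) fun j => ξ N j ω :=
      ae_all_iff.2 fun p =>
        ScaledScenario.ae_eventually_gridCell_hit hξm hξi hξP _ (by positivity)
    obtain ⟨S, hSm, hS, hSsub⟩ : ∃ S : Set Ω, MeasurableSet S ∧ μ S = 1 ∧ ∀ ω ∈ S, ∀ p : ℕ,
        ∀ᶠ N : ℕ in atTop, ScaledScenario.HitsCells P (1 / (p + 1 : ℝ)) fun j => ξ N j ω := by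
      obtain ⟨T, hT, hTm, hT0⟩ := exists_measurable_superset_of_null (ae_iff.1 hae)
      refine ⟨Tᶜ, hTm.compl, by rw [prob_compl_eq_one_sub hTm, hT0, tsub_zero], fun ω hω => ?_⟩
      by_contra hcon
      exact hω (hT hcon)
    refine ⟨S, hSm, ?_, fun ω hω N x hNx => ?_⟩
    · rw [hS, ← ENNReal.ofReal_one]
      exact ENNReal.ofReal_le_ofReal (by linarith [hβ.1])
    · have key : ∀ δ : ℝ, 0 < δ → ∀ᶠ ε in 𝓝[>] (0 : ℝ),
          ScaledScenario.violation A P (x ε) ≤ ENNReal.ofReal (ε ^ (1 - δ)) := by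
        intro δ hδ
        refine ScaledScenario.eventually_violation_le_rpow A hs0 hβ
          (F := fun N => {x | ScaledScenario.Feasible X A s (fun j => ξ N j ω) x})
          (fun ρ hρ => ?_) hNx hδ
        obtain ⟨p, hp⟩ := hP.exists_eventually_violation_le hC hXc.isBounded A hs0 hρ
        filter_upwards [hp, hSsub ω hω p] with N hN hhit x hx
        exact hN _ hhit x hx
      exact ⟨ScaledScenario.one_le_liminf_log_div_log key, key⟩
  · rw [one_div, ← Real.rpow_neg hs0.le]
    exact ScaledScenario.tendsto_log_sampleSize_ratio n hβ (by positivity)
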